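/- Let $G$ be a finite simple graph. A configuration on $G$ is a function $C\colon V(G)\to\mathbb{Z}$ (stack sizes). Firing $C$ produces the configuration in which the stack size of every vertex $v$ is $$C(v)+\#\{u\sim v : C(u)>C(v)\}-\#\{u\sim v : C(u)<C(v)\}.$$ Let $C_0, C_1, C_2,\dots$ be the sequence obtained from $C_0$ by repeated firing. A configuration $D$ is a period configuration if $D=C_k$ for some initial configuration $C_0$ and some $k\ge N$, where $N\ge 0$ and $p\ge 1$ satisfy $C_{t+p}=C_t$ for all $t\ge N$. Let $a_k$ be the number of period configurations on the unlabelled complete graph $K_k$, where two configurations are identified if one is obtained from the other by permuting the vertices and adding the same integer to all stack sizes (this number is finite for every $k$). Then there are real numbers $c$ and $\alpha$ with $$a_k\sim c\,\alpha^k\qquad(k\to\infty),\qquad c\approx 0.1809,\quad \alpha\approx 3.2056,$$ where $\alpha$ is the real root of $x^3-5x^2+7x-4$. The other two roots $\beta,\bar\beta$ of this polynomial are non-real, have modulus $|\beta|\approx 1.1171$, and are strictly dominated by $\alpha$, i.e. $|\beta|<\alpha$. (All approximations hold with error less than $5\cdot 10^{-5}$.) -/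

import Mathlib

namespace Diffusion

/-- A configuration assigns an integral stack size to every vertex. -/
abbrev Configuration (V : Type*) : Type _ := V → ℤ

section

variable {V : Type*} [Fintype V] (G : SimpleGraph V) [DecidableRel G.Adj]

/-- The neighbours of `v` that are poorer than `v` in `C`. -/
def poorer (C : Configuration V) (v : V) : Finset V :=
  Finset.univ.filter fun u => G.Adj v u ∧ C u < C v

/-- The neighbours of `v` that are richer than `v` in `C`. -/
def richer (C : Configuration V) (v : V) : Finset V :=
  Finset.univ.filter fun u => G.Adj v u ∧ C v < C u

/-- One step of Parallel Diffusion: every vertex simultaneously sends one chip to each of its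
poorer neighbours. -/
def fire (C : Configuration V) : Configuration V := fun v =>
  C v + ((richer G C v).card : ℤ) - ((poorer G C v).card : ℤ)

/-- The configuration at step `t` of the configuration sequence with initial configuration `C`. -/
def configAt (C : Configuration V) (t : ℕ) : Configuration V := (fire G)^[t] C

/-- `p` is a period length and `N` a preperiod length of the configuration sequence of `C`. -/
def IsPeriodFrom (C : Configuration V) (N p : ℕ) : Prop :=
  0 < p ∧ ∀ t, N ≤ t → configAt G C (t + p) = configAt G C t

/-- `D` is a period configuration: it lies inside the period of some configuration sequence. -/
def IsPeriodConfiguration (D : Configuration V) : Prop :=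
  ∃ (C : Configuration V) (N p : ℕ), IsPeriodFrom G C N p ∧ ∃ k, N ≤ k ∧ D = configAt G C k

/-- The period configurations on the (labelled) graph `G`. -/
abbrev PeriodConfiguration : Type _ := {D : Configuration V // IsPeriodConfiguration G D}

/-- Two period configurations are identified if they agree after forgetting the labels of the
vertices (that is, up to an automorphism of the graph) and adding a constant integer to all
stack sizes. -/
def unlabelledSetoid : Setoid (PeriodConfiguration G) where
  r C D := ∃ (σ : G ≃g G) (m : ℤ), ∀ v, D.1 (σ v) = C.1 v + m
  iseqv :=
    { refl := fun C => ⟨SimpleGraph.Iso.refl, 0, fun v => by simp⟩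
      symm := by
        rintro C D ⟨σ, m, h⟩
        refine ⟨σ.symm, -m, fun v => ?_⟩
        have h' := h (σ.symm v)
        rw [RelIso.apply_symm_apply] at h'
        rw [h']
        ring
      trans := by
        rintro C D E ⟨σ, m, h⟩ ⟨τ, l, h'⟩
        refine ⟨σ.trans τ, m + l, fun v => ?_⟩
        rw [RelIso.trans_apply, h', h]
        ring }

/-- The period configurations on the unlabelled graph `G`, up to equivalence. -/
abbrev UnlabelledPeriodConfiguration : Type _ := Quotient (unlabelledSetoid G)

end

/-- The number `a_k` of period configurations on the unlabelled complete graph `K_k`. -/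
noncomputable def periodCount (k : ℕ) : ℕ :=
  Nat.card (UnlabelledPeriodConfiguration (⊤ : SimpleGraph (Fin k)))

end Diffusion

namespace Diffusion

section Dynamics

variable {V : Type*} [Fintype V] [DecidableEq V]

theorem fire_top_apply (C : Configuration V) (v : V) :
    fire (⊤ : SimpleGraph V) C v = C v + ∑ u, (C u - C v).sign := by
  have h : ∀ u, (C u - C v).sign =
      (if (⊤ : SimpleGraph V).Adj v u ∧ C v < C u then 1 else 0) -
        (if (⊤ : SimpleGraph V).Adj v u ∧ C u < C v then (1 : ℤ) else 0) := by
    intro u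
    rcases lt_trichotomy (C u) (C v) with hlt | heq | hgt
    · have hne : v ≠ u := by rintro rfl; exact lt_irrefl _ hlt
      rw [Int.sign_eq_neg_one_of_neg (by linarith)]
      simp [hne, hlt, hlt.le.not_gt]
    · simp [heq]
    · have hne : v ≠ u := by rintro rfl; exact lt_irrefl _ hgt
      rw [Int.sign_eq_one_of_pos (by linarith)]
      simp [hne, hgt, hgt.le.not_gt]
  simp only [fire, richer, poorer, Finset.card_filter, h, Finset.sum_sub_distrib]
  push_cast
  ring

/-- A configuration is reversing if firing reverses the order of the stack sizes. -/
def IsReversing (C : Configuration V) : Prop :=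
  ∀ u v, C u < C v → fire (⊤ : SimpleGraph V) C v < fire (⊤ : SimpleGraph V) C u

/-- A quadratic energy that does not increase under firing. -/
def energy (C : Configuration V) : ℤ :=
  2 * ∑ v, C v ^ 2 - ∑ u, ∑ v, |C u - C v|

theorem energy_sub_energy_fire (C : Configuration V) :
    energy C - energy (fire (⊤ : SimpleGraph V) C) =
      ∑ u, ∑ v, (|fire (⊤ : SimpleGraph V) C u - fire (⊤ : SimpleGraph V) C v| +
        (fire (⊤ : SimpleGraph V) C u - fire (⊤ : SimpleGraph V) C v) * (C u - C v).sign) := by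
  set D := fire (⊤ : SimpleGraph V) C with hD
  have h1 : ∑ v, D v ^ 2 - ∑ v, C v ^ 2 = ∑ u, ∑ v, (C v + D v) * (C u - C v).sign := by
    rw [Finset.sum_comm, ← Finset.sum_sub_distrib]
    refine Finset.sum_congr rfl fun v _ => ?_
    rw [← Finset.mul_sum, show ∑ u, (C u - C v).sign = D v - C v by
      rw [hD, fire_top_apply]; ring]
    ring
  have h2 : ∑ v, D v ^ 2 - ∑ v, C v ^ 2 = -∑ u, ∑ v, (C u + D u) * (C u - C v).sign := by
    rw [h1, Finset.sum_comm, ← Finset.sum_neg_distrib]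
    refine Finset.sum_congr rfl fun v _ => ?_
    rw [← Finset.sum_neg_distrib]
    refine Finset.sum_congr rfl fun u _ => ?_
    rw [← neg_sub (C v) (C u), Int.sign_neg]
    ring
  have h3 : ∑ u, ∑ v, |C u - C v| = ∑ u, ∑ v, (C u - C v) * (C u - C v).sign := by
    refine Finset.sum_congr rfl fun v _ => Finset.sum_congr rfl fun u _ => ?_
    rw [mul_comm, Int.sign_mul_self_eq_abs]
  have h4 : 2 * (∑ v, C v ^ 2 - ∑ v, D v ^ 2) - ∑ u, ∑ v, |C u - C v| =
      ∑ u, ∑ v, (D u - D v) * (C u - C v).sign := by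
    have : 2 * (∑ v, C v ^ 2 - ∑ v, D v ^ 2) =
        ∑ u, ∑ v, (C u + D u) * (C u - C v).sign -
          ∑ u, ∑ v, (C v + D v) * (C u - C v).sign := by linarith
    rw [this, h3]
    simp only [← Finset.sum_sub_distrib]
    refine Finset.sum_congr rfl fun v _ => Finset.sum_congr rfl fun u _ => ?_
    ring
  simp only [Finset.sum_add_distrib, ← h4, energy]
  ring

theorem abs_add_mul_sign_nonneg (a b : ℤ) : 0 ≤ |a| + a * b.sign := by
  rcases lt_trichotomy b 0 with h | h | h
  · rw [Int.sign_eq_neg_one_of_neg h]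
    linarith [le_abs_self a]
  · simp [h]
  · rw [Int.sign_eq_one_of_pos h]
    linarith [neg_le_abs a]

theorem energy_fire_le (C : Configuration V) :
    energy (fire (⊤ : SimpleGraph V) C) ≤ energy C := by
  rw [← sub_nonneg, energy_sub_energy_fire]
  exact Finset.sum_nonneg fun u _ => Finset.sum_nonneg fun v _ => abs_add_mul_sign_nonneg _ _

theorem energy_iterate_fire_le (C : Configuration V) (n : ℕ) :
    energy ((fire (⊤ : SimpleGraph V))^[n] C) ≤ energy C := by
  induction n with
  | zero => exact le_rfl
  | succ n ih =>
    rw [Function.iterate_succ_apply']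
    exact (energy_fire_le _).trans ih

theorem iterate_fire_eq_of_eq {C : Configuration V} {u v : V} (h : C u = C v) (n : ℕ) :
    (fire (⊤ : SimpleGraph V))^[n] C u = (fire (⊤ : SimpleGraph V))^[n] C v := by
  induction n with
  | zero => exact h
  | succ n ih => rw [Function.iterate_succ_apply', fire_top_apply, fire_top_apply, ih]

theorem isReversing_of_iterate_fire_eq {C : Configuration V} {p : ℕ} (hp : 0 < p)
    (h : (fire (⊤ : SimpleGraph V))^[p] C = C) : IsReversing C := by
  obtain ⟨p, rfl⟩ := Nat.exists_eq_succ_of_ne_zero hp.ne'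
  rw [Function.iterate_succ_apply] at h
  have hE : energy C - energy (fire (⊤ : SimpleGraph V) C) = 0 := by
    have h1 := energy_iterate_fire_le (fire (⊤ : SimpleGraph V) C) p
    rw [h] at h1
    linarith [energy_fire_le C]
  rw [energy_sub_energy_fire, Finset.sum_eq_zero_iff_of_nonneg
    fun u _ => Finset.sum_nonneg fun v _ => abs_add_mul_sign_nonneg _ _] at hE
  intro u v huv
  have h1 := hE u (Finset.mem_univ _)
  rw [Finset.sum_eq_zero_iff_of_nonneg fun v _ => abs_add_mul_sign_nonneg _ _] at h1
  have h2 := h1 v (Finset.mem_univ _)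
  rw [Int.sign_eq_neg_one_of_neg (by linarith)] at h2
  refine lt_of_le_of_ne ?_ fun heq => huv.ne' ?_
  · linarith [abs_nonneg (fire (⊤ : SimpleGraph V) C u - fire (⊤ : SimpleGraph V) C v)]
  · have := iterate_fire_eq_of_eq heq p
    rwa [h] at this

theorem IsReversing.fire_fire {C : Configuration V} (h : IsReversing C) :
    fire (⊤ : SimpleGraph V) (fire (⊤ : SimpleGraph V) C) = C := by
  funext v
  have hs : ∀ u, (fire (⊤ : SimpleGraph V) C u - fire (⊤ : SimpleGraph V) C v).sign =
      -(C u - C v).sign := by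
    intro u
    rcases lt_trichotomy (C u) (C v) with hlt | heq | hgt
    · rw [Int.sign_eq_neg_one_of_neg (sub_neg.2 hlt),
        Int.sign_eq_one_of_pos (sub_pos.2 (h u v hlt)), neg_neg]
    · have := iterate_fire_eq_of_eq heq 1
      simp only [Function.iterate_one] at this
      simp [heq, this]
    · rw [Int.sign_eq_one_of_pos (sub_pos.2 hgt),
        Int.sign_eq_neg_one_of_neg (sub_neg.2 (h v u hgt))]
  rw [fire_top_apply, Finset.sum_congr rfl fun u _ => hs u, Finset.sum_neg_distrib,
    fire_top_apply]
  ring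

theorem isPeriodConfiguration_top_iff (D : Configuration V) :
    IsPeriodConfiguration (⊤ : SimpleGraph V) D ↔ IsReversing D := by
  constructor
  · rintro ⟨C, N, p, ⟨hp, hC⟩, k, hk, rfl⟩
    refine isReversing_of_iterate_fire_eq hp ?_
    have := hC k hk
    rwa [configAt, add_comm, Function.iterate_add_apply] at this
  · intro h
    refine ⟨D, 0, 2, ⟨two_pos, fun t _ => ?_⟩, 0, le_rfl, rfl⟩
    rw [configAt, Function.iterate_add_apply]
    exact congrArg _ h.fire_fire

end Dynamics

section Unlabelled

/-- The multiset of stack sizes of a reversing configuration. -/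
def IsReversingMultiset (s : Multiset ℕ) : Prop :=
  ∀ x ∈ s, ∀ y ∈ s, x < y →
    y + s.countP (y < ·) + s.countP (· < x) < x + s.countP (x < ·) + s.countP (· < y)

/-- The multisets of `k` stack sizes with minimum `0` that belong to reversing configurations. -/
def reversingMultisets (k : ℕ) : Set (Multiset ℕ) :=
  {s | s.card = k ∧ 0 ∈ s ∧ IsReversingMultiset s}

theorem exists_perm_of_map_univ_val_eq {V α : Type*} [Fintype V] {f g : V → α}
    (h : Finset.univ.val.map f = Finset.univ.val.map g) :
    ∃ σ : Equiv.Perm V, ∀ v, g (σ v) = f v := by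
  classical
  have e : ∀ x, Nonempty ({v // f v = x} ≃ {v // g v = x}) := by
    intro x
    rw [← Fintype.card_eq, Fintype.card_subtype, Fintype.card_subtype]
    have := congrArg (Multiset.count x) h
    rw [Multiset.count_map, Multiset.count_map] at this
    simpa [Finset.card_def, eq_comm] using this
  let e := fun x => (e x).some
  let σ : V ≃ V := (Equiv.sigmaFiberEquiv f).symm.trans
    ((Equiv.sigmaCongrRight e).trans (Equiv.sigmaFiberEquiv g))
  exact ⟨σ, fun v => (e (f v) ⟨v, rfl⟩).2⟩

variable {V : Type*} [Fintype V]

theorem countP_map_univ_val {α : Type*} (f : V → α) (p : α → Prop) [DecidablePred p] :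
    (Finset.univ.val.map f).countP p = (Finset.univ.filter fun v => p (f v)).card := by
  rw [Multiset.countP_map]
  rfl

section Minimum

variable [Nonempty V]

/-- The smallest stack size. -/
def minStack (D : Configuration V) : ℤ := Finset.univ.inf' Finset.univ_nonempty D

/-- The stack sizes above the smallest one, without the labels of the vertices. -/
def stackMultiset (D : Configuration V) : Multiset ℕ :=
  Finset.univ.val.map fun v => (D v - minStack D).toNat

theorem minStack_le (D : Configuration V) (v : V) : minStack D ≤ D v :=
  Finset.inf'_le _ (Finset.mem_univ v)

theorem exists_eq_minStack (D : Configuration V) : ∃ v, D v = minStack D := by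
  obtain ⟨v, -, h⟩ := Finset.exists_mem_eq_inf' (Finset.univ_nonempty (α := V)) D
  exact ⟨v, h.symm⟩

theorem minStack_eq {D : Configuration V} {m : ℤ} (h : ∀ v, m ≤ D v) {v : V} (hv : D v = m) :
    minStack D = m :=
  le_antisymm (hv ▸ minStack_le D v) (Finset.le_inf' _ _ fun v _ => h v)

theorem eq_toNat_add_minStack (D : Configuration V) (v : V) :
    D v = ((D v - minStack D).toNat : ℤ) + minStack D := by
  have := minStack_le D v
  omega

theorem stackMultiset_eq_iff (C D : Configuration V) :
    stackMultiset C = stackMultiset D ↔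
      ∃ (σ : (⊤ : SimpleGraph V) ≃g (⊤ : SimpleGraph V)) (m : ℤ), ∀ v, D (σ v) = C v + m := by
  constructor
  · intro h
    obtain ⟨σ, hσ⟩ := exists_perm_of_map_univ_val_eq h
    refine ⟨⟨σ, by simp⟩, minStack D - minStack C, fun v => ?_⟩
    have h1 := hσ v
    have h2 := eq_toNat_add_minStack D (σ v)
    have h3 := eq_toNat_add_minStack C v
    change D (σ v) = _
    omega
  · rintro ⟨σ, m, h⟩
    have hm : minStack D = minStack C + m := by
      obtain ⟨v, hv⟩ := exists_eq_minStack C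
      refine minStack_eq (v := σ v) (fun u => ?_) (by rw [h, hv])
      have := h (σ.symm u)
      rw [RelIso.apply_symm_apply] at this
      rw [this]
      linarith [minStack_le C (σ.symm u)]
    rw [stackMultiset, stackMultiset]
    conv_rhs => rw [← Multiset.map_univ_val_equiv σ.toEquiv, Multiset.map_map]
    refine Multiset.map_congr rfl fun v _ => ?_
    have := h v
    simp only [Function.comp_apply, hm]
    congr 1
    change _ = D (σ v) - _
    rw [this]
    ring

end Minimum

variable [DecidableEq V]

theorem isReversing_iff_of_eq_add {D : Configuration V} {E : V → ℕ} {m : ℤ}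
    (h : ∀ v, D v = E v + m) :
    IsReversing D ↔ IsReversingMultiset (Finset.univ.val.map E) := by
  have hr : ∀ v, (richer (⊤ : SimpleGraph V) D v).card =
      (Finset.univ.val.map E).countP (E v < ·) := by
    intro v
    rw [countP_map_univ_val, richer]
    congr 1
    ext u
    simp only [Finset.mem_filter, Finset.mem_univ, true_and, SimpleGraph.top_adj, h,
      add_lt_add_iff_right, Nat.cast_lt, and_iff_right_iff_imp]
    rintro hlt rfl
    exact lt_irrefl _ hlt
  have hp : ∀ v, (poorer (⊤ : SimpleGraph V) D v).card =
      (Finset.univ.val.map E).countP (· < E v) := by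
    intro v
    rw [countP_map_univ_val, poorer]
    congr 1
    ext u
    simp only [Finset.mem_filter, Finset.mem_univ, true_and, SimpleGraph.top_adj, h,
      add_lt_add_iff_right, Nat.cast_lt, and_iff_right_iff_imp]
    rintro hlt rfl
    exact lt_irrefl _ hlt
  have key : ∀ u v, (D u < D v → fire (⊤ : SimpleGraph V) D v < fire (⊤ : SimpleGraph V) D u) ↔
      (E u < E v → E v + (Finset.univ.val.map E).countP (E v < ·) +
        (Finset.univ.val.map E).countP (· < E u) <
        E u + (Finset.univ.val.map E).countP (E u < ·) +
          (Finset.univ.val.map E).countP (· < E v)) := by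
    intro u v
    simp only [fire, hr, hp, h u, h v]
    omega
  simp only [IsReversing, key, IsReversingMultiset, Multiset.mem_map, Finset.mem_val,
    Finset.mem_univ, true_and, forall_exists_index, forall_apply_eq_imp_iff]

variable [Nonempty V]

theorem range_stackMultiset :
    Set.range (fun D : PeriodConfiguration (⊤ : SimpleGraph V) => stackMultiset D.1) =
      reversingMultisets (Fintype.card V) := by
  ext s
  constructor
  · rintro ⟨⟨D, hD⟩, rfl⟩
    refine ⟨by simp [stackMultiset, Finset.card_univ], ?_, ?_⟩
    · obtain ⟨v, hv⟩ := exists_eq_minStack D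
      exact Multiset.mem_map.2 ⟨v, Finset.mem_univ v, by simp [hv]⟩
    · exact (isReversing_iff_of_eq_add (eq_toNat_add_minStack D)).1
        ((isPeriodConfiguration_top_iff D).1 hD)
  · rintro ⟨hc, h0, hs⟩
    obtain ⟨E, rfl⟩ : ∃ E : V → ℕ, Finset.univ.val.map E = s := by
      obtain ⟨l, rfl⟩ := Quot.exists_rep s
      have hl : l.length = Fintype.card V := hc
      let e : V ≃ Fin l.length := Fintype.equivFinOfCardEq hl.symm
      refine ⟨fun v => l.get (e v), ?_⟩
      have := congrArg (Multiset.map l.get) (Multiset.map_univ_val_equiv e)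
      rw [Multiset.map_map] at this
      refine this.trans ?_
      simp [Fin.univ_def]
    let D : Configuration V := fun v => E v
    obtain ⟨v, -, hv⟩ := Multiset.mem_map.1 h0
    have hm : minStack D = 0 := minStack_eq (v := v) (fun v => by simp [D]) (by simp [D, hv])
    refine ⟨⟨D, (isPeriodConfiguration_top_iff D).2
      ((isReversing_iff_of_eq_add (E := E) (m := 0) fun v => by simp [D]).2 hs)⟩, ?_⟩
    simp [stackMultiset, hm, D]

/-- Unlabelled period configurations on a complete graph are multisets of stack sizes. -/
noncomputable def unlabelledEquiv :
    UnlabelledPeriodConfiguration (⊤ : SimpleGraph V) ≃ reversingMultisets (Fintype.card V) :=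
  (Quotient.congrRight (r := unlabelledSetoid (⊤ : SimpleGraph V))
    (r' := Setoid.ker fun D : PeriodConfiguration (⊤ : SimpleGraph V) => stackMultiset D.1)
    fun C D => (stackMultiset_eq_iff C.1 D.1).symm).trans
  ((Setoid.quotientKerEquivRange _).trans (Equiv.setCongr range_stackMultiset))

end Unlabelled

section Counting

/-- `n` stacks of size `0` below the stacks of `t` raised by `d`. -/
def glue (n d : ℕ) (t : Multiset ℕ) : Multiset ℕ :=
  Multiset.replicate n 0 + t.map (· + d)

theorem card_glue (n d : ℕ) (t : Multiset ℕ) : (glue n d t).card = n + t.card := by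
  simp [glue]

theorem mem_glue {n d : ℕ} {t : Multiset ℕ} {x : ℕ} :
    x ∈ glue n d t ↔ (n ≠ 0 ∧ x = 0) ∨ ∃ y ∈ t, y + d = x := by
  simp [glue, Multiset.mem_replicate]

theorem filter_pos_glue {n d : ℕ} (hd : 0 < d) (t : Multiset ℕ) :
    (glue n d t).filter (0 < ·) = t.map (· + d) := by
  rw [glue, Multiset.filter_add, Multiset.filter_eq_nil.2, zero_add, Multiset.filter_eq_self.2]
  · intro x hx
    obtain ⟨y, -, rfl⟩ := Multiset.mem_map.1 hx
    omega
  · intro x hx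
    rw [Multiset.eq_of_mem_replicate hx]
    exact lt_irrefl 0

theorem count_zero_glue {n d : ℕ} (hd : 0 < d) (t : Multiset ℕ) :
    (glue n d t).count 0 = n := by
  rw [glue, Multiset.count_add, Multiset.count_replicate_self, Multiset.count_eq_zero.2, add_zero]
  intro h
  obtain ⟨y, -, hy⟩ := Multiset.mem_map.1 h
  omega

theorem countP_glue (n d : ℕ) (t : Multiset ℕ) (p : ℕ → Prop) [DecidablePred p] :
    (glue n d t).countP p = (if p 0 then n else 0) + t.countP (fun y => p (y + d)) := by
  rw [glue, Multiset.countP_add]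
  congr 1
  · split_ifs with h
    · rw [Multiset.countP_eq_card.2 fun x hx => by rwa [Multiset.eq_of_mem_replicate hx],
        Multiset.card_replicate]
    · exact Multiset.countP_eq_zero.2 fun x hx => by rwa [Multiset.eq_of_mem_replicate hx]
  · rw [Multiset.countP_map, Multiset.countP_eq_card_filter]

theorem countP_pos_add_count_zero (t : Multiset ℕ) :
    t.countP (0 < ·) + t.count 0 = t.card := by
  rw [Multiset.card_eq_countP_add_countP (0 < ·) t, Multiset.count]
  congr 1
  exact Multiset.countP_congr rfl fun x _ => by simp [eq_comm]

theorem isReversingMultiset_glue_iff {n d : ℕ} {t : Multiset ℕ} (hn : 0 < n) (hd : 0 < d)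
    (h0 : 0 ∈ t) :
    IsReversingMultiset (glue n d t) ↔ IsReversingMultiset t ∧ d < n + t.count 0 := by
  have hc := countP_pos_add_count_zero t
  have hz : t.countP (· < 0) = 0 := Multiset.countP_eq_zero.2 fun x _ => Nat.not_lt_zero x
  have hgt : ∀ y, (glue n d t).countP (y + d < ·) = t.countP (y < ·) := by
    intro y
    simp [countP_glue]
  have hlt : ∀ y, (glue n d t).countP (· < y + d) = n + t.countP (· < y) := by
    intro y
    simp [countP_glue, hd]
  have hgt0 : (glue n d t).countP (0 < ·) = t.card := by
    rw [countP_glue, if_neg (lt_irrefl 0), zero_add]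
    exact Multiset.countP_eq_card.2 fun x _ => by omega
  have hlt0 : (glue n d t).countP (· < 0) = 0 :=
    Multiset.countP_eq_zero.2 fun x _ => Nat.not_lt_zero x
  constructor
  · intro h
    constructor
    · intro x hx y hy hxy
      have := h (x + d) (mem_glue.2 (Or.inr ⟨x, hx, rfl⟩)) (y + d)
        (mem_glue.2 (Or.inr ⟨y, hy, rfl⟩)) (by omega)
      rw [hgt, hgt, hlt, hlt] at this
      omega
    · have := h 0 (mem_glue.2 (Or.inl ⟨hn.ne', rfl⟩)) (0 + d)
        (mem_glue.2 (Or.inr ⟨0, h0, rfl⟩)) (by omega)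
      rw [hgt, hlt, hgt0, hlt0] at this
      omega
  · rintro ⟨h, hdn⟩ x hx y hy hxy
    obtain ⟨-, rfl⟩ | ⟨x, hxt, rfl⟩ := mem_glue.1 hx <;>
      obtain ⟨-, rfl⟩ | ⟨y, hyt, rfl⟩ := mem_glue.1 hy
    · omega
    · rw [hgt, hlt, hgt0, hlt0]
      rcases Nat.eq_zero_or_pos y with rfl | hy0
      · omega
      · have := h 0 h0 y hyt hy0
        omega
    · omega
    · rw [hgt, hgt, hlt, hlt]
      have := h x hxt y hyt (by omega)
      omega

theorem exists_eq_glue {s : Multiset ℕ} (h : s.count 0 < s.card) :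
    ∃ d t, 0 < d ∧ 0 ∈ t ∧ s = glue (s.count 0) d t := by
  have hs : s = Multiset.replicate (s.count 0) 0 + s.filter (0 < ·) := by
    conv_lhs => rw [← Multiset.filter_add_not (0 < ·) s, add_comm]
    congr 1
    rw [← Multiset.filter_eq]
    exact Multiset.filter_congr fun x _ => by simp [eq_comm]
  have hpos : ∃ d, d ∈ s.filter (0 < ·) := by
    apply Multiset.exists_mem_of_ne_zero
    intro h0
    rw [h0, add_zero] at hs
    have := congrArg Multiset.card hs
    rw [Multiset.card_replicate] at this
    omega
  classical
  let d := Nat.find hpos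
  have hd : d ∈ s.filter (0 < ·) := Nat.find_spec hpos
  have hmin : ∀ x ∈ s.filter (0 < ·), d ≤ x := fun x hx => Nat.find_min' hpos hx
  refine ⟨d, (s.filter (0 < ·)).map (· - d), (Multiset.mem_filter.1 hd).2,
    Multiset.mem_map.2 ⟨d, hd, Nat.sub_self d⟩, ?_⟩
  rw [glue, Multiset.map_map]
  conv_lhs => rw [hs]
  congr 1
  conv_lhs => rw [← Multiset.map_id (s.filter (0 < ·))]
  refine Multiset.map_congr rfl fun x hx => ?_
  have := hmin x hx
  simp only [id, Function.comp_apply]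
  omega

theorem glue_injective {n n' d d' : ℕ} {t t' : Multiset ℕ} (hd : 0 < d) (hd' : 0 < d')
    (h0 : 0 ∈ t) (h0' : 0 ∈ t') (h : glue n d t = glue n' d' t') : n = n' ∧ t = t' ∧ d = d' := by
  have hn : n = n' := by rw [← count_zero_glue (n := n) hd t, h, count_zero_glue hd']
  have ht : t.map (· + d) = t'.map (· + d') := by
    rw [← filter_pos_glue (n := n) hd t, h, filter_pos_glue hd']
  have hdd : d = d' := by
    have h1 : d ∈ t'.map (· + d') := ht ▸ Multiset.mem_map.2 ⟨0, h0, zero_add d⟩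
    have h2 : d' ∈ t.map (· + d) := ht ▸ Multiset.mem_map.2 ⟨0, h0', zero_add d'⟩
    obtain ⟨a, -, ha⟩ := Multiset.mem_map.1 h1
    obtain ⟨b, -, hb⟩ := Multiset.mem_map.1 h2
    omega
  subst hdd
  exact ⟨hn, Multiset.map_injective (add_left_injective d) ht, rfl⟩

theorem finite_reversingMultisets (k : ℕ) : (reversingMultisets k).Finite := by
  refine (Set.finite_Iic (k • Multiset.range (2 * k))).subset ?_
  rintro s ⟨hc, h0, hs⟩
  refine Multiset.le_iff_count.2 fun x => ?_
  rw [Multiset.count_nsmul]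
  by_cases hx : x ∈ s
  · have hxk : x < 2 * k := by
      have h1 := Multiset.countP_le_card (0 < ·) s
      have h2 := Multiset.countP_le_card (· < x) s
      have h3 := Multiset.card_pos_iff_exists_mem.2 ⟨x, hx⟩
      rcases Nat.eq_zero_or_pos x with rfl | hx0
      · omega
      · have := hs 0 h0 x hx hx0
        omega
    rw [Multiset.count_eq_one_of_mem (Multiset.nodup_range _) (Multiset.mem_range.2 hxk), mul_one,
      ← hc]
    exact Multiset.count_le_card x s
  · rw [Multiset.count_eq_zero.2 hx]
    exact Nat.zero_le _

/-- The elements of `reversingMultisets k` as a finset. -/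
noncomputable def reversingFinset (k : ℕ) : Finset (Multiset ℕ) :=
  (finite_reversingMultisets k).toFinset

theorem mem_reversingFinset {k : ℕ} {s : Multiset ℕ} :
    s ∈ reversingFinset k ↔ s.card = k ∧ 0 ∈ s ∧ IsReversingMultiset s := by
  simp [reversingFinset, reversingMultisets]

/-- The ways to put a block of zeros below a smaller multiset. -/
noncomputable def glueData (k : ℕ) : Finset (Σ _ : ℕ, Σ _ : Multiset ℕ, ℕ) :=
  (Finset.Ico 1 k).sigma fun n => (reversingFinset (k - n)).sigma fun t =>
    Finset.Ico 1 (n + t.count 0)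

theorem mem_glueData {k n d : ℕ} {t : Multiset ℕ} :
    (⟨n, t, d⟩ : Σ _ : ℕ, Σ _ : Multiset ℕ, ℕ) ∈ glueData k ↔
      (0 < n ∧ n < k) ∧ (t.card = k - n ∧ 0 ∈ t ∧ IsReversingMultiset t) ∧
        0 < d ∧ d < n + t.count 0 := by
  simp [glueData, mem_reversingFinset, Nat.succ_le_iff]

theorem reversingFinset_eq {k : ℕ} (hk : 0 < k) :
    reversingFinset k = insert (Multiset.replicate k 0)
      ((glueData k).image fun i => glue i.1 i.2.2 i.2.1) := by
  ext s
  rw [mem_reversingFinset, Finset.mem_insert, Finset.mem_image]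
  constructor
  · rintro ⟨hc, h0, hs⟩
    rcases (Multiset.count_le_card 0 s).eq_or_lt with h | h
    · left
      rw [Multiset.eq_replicate]
      exact ⟨hc, fun b hb => (Multiset.count_eq_card.1 h b hb).symm⟩
    · right
      have hn := Multiset.count_pos.2 h0
      obtain ⟨d, t, hd, ht, hst⟩ := exists_eq_glue h
      have hcard := congrArg Multiset.card hst
      rw [card_glue] at hcard
      rw [hst, isReversingMultiset_glue_iff hn hd ht] at hs
      exact ⟨⟨s.count 0, t, d⟩, mem_glueData.2
        ⟨⟨hn, hc ▸ h⟩, ⟨by omega, ht, hs.1⟩, hd, hs.2⟩, hst.symm⟩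
  · rintro (rfl | ⟨⟨n, t, d⟩, hi, rfl⟩)
    · refine ⟨Multiset.card_replicate _ _, Multiset.mem_replicate.2 ⟨hk.ne', rfl⟩, ?_⟩
      intro x hx y hy hxy
      rw [Multiset.eq_of_mem_replicate hx, Multiset.eq_of_mem_replicate hy] at hxy
      omega
    · obtain ⟨⟨hn, hnk⟩, ⟨hc, h0, ht⟩, hd, hdn⟩ := mem_glueData.1 hi
      refine ⟨?_, mem_glue.2 (Or.inl ⟨hn.ne', rfl⟩),
        (isReversingMultiset_glue_iff hn hd h0).2 ⟨ht, hdn⟩⟩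
      rw [card_glue]
      dsimp only
      omega

theorem sum_reversingFinset {k : ℕ} (hk : 0 < k) (f : ℕ → ℕ) :
    ∑ s ∈ reversingFinset k, f (s.count 0) =
      f k + ∑ n ∈ Finset.Ico 1 k, f n * ((n - 1) * (reversingFinset (k - n)).card +
        ∑ t ∈ reversingFinset (k - n), t.count 0) := by
  rw [reversingFinset_eq hk, Finset.sum_insert, Finset.sum_image]
  · rw [Multiset.count_replicate_self]
    congr 1
    rw [glueData, Finset.sum_sigma]
    refine Finset.sum_congr rfl fun n hn => ?_
    rw [Finset.sum_sigma, mul_add, ← mul_assoc, Finset.mul_sum, mul_comm _ (Finset.card _),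
      ← smul_eq_mul, ← Finset.sum_const, ← Finset.sum_add_distrib]
    refine Finset.sum_congr rfl fun t _ => ?_
    have hn1 := (Finset.mem_Ico.1 hn).1
    rw [Finset.sum_congr rfl (g := fun _ => f n) fun d hd => by
        rw [count_zero_glue (Finset.mem_Ico.1 hd).1],
      Finset.sum_const, Nat.card_Ico, smul_eq_mul, ← mul_add, mul_comm]
    congr 1
    omega
  · rintro ⟨n, t, d⟩ hi ⟨n', t', d'⟩ hi' h
    have hi := mem_glueData.1 hi
    have hi' := mem_glueData.1 hi'
    obtain ⟨rfl, rfl, rfl⟩ := glue_injective hi.2.2.1 hi'.2.2.1 hi.2.1.2.1 hi'.2.1.2.1 h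
    rfl
  · intro h
    obtain ⟨⟨n, t, d⟩, hi, h⟩ := Finset.mem_image.1 h
    obtain ⟨⟨hn, hnk⟩, -, hd, -⟩ := mem_glueData.1 hi
    have := congrArg (Multiset.count 0) h
    rw [count_zero_glue hd, Multiset.count_replicate_self] at this
    dsimp only at this
    omega

end Counting

section Recurrence

/-- The number of reversing multisets of `k + 1` stack sizes. -/
noncomputable def multisetCount (k : ℕ) : ℝ := (reversingFinset (k + 1)).card

/-- The total number of zeros in the reversing multisets of `k + 1` stack sizes. -/
noncomputable def zeroCount (k : ℕ) : ℝ := ∑ s ∈ reversingFinset (k + 1), (s.count 0 : ℝ)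

theorem sum_reversingFinset_succ (k : ℕ) (f : ℕ → ℕ) :
    ∑ s ∈ reversingFinset (k + 1), (f (s.count 0) : ℝ) =
      f (k + 1) + ∑ j ∈ Finset.range k,
        (f (k - j) : ℝ) * (((k : ℝ) - 1 - j) * multisetCount j + zeroCount j) := by
  have h := congrArg (Nat.cast (R := ℝ)) (sum_reversingFinset k.succ_pos f)
  rw [Nat.cast_sum] at h
  rw [h, Nat.cast_add, Nat.cast_sum, Finset.sum_Ico_eq_sum_range, Nat.succ_sub_one,
    ← Finset.sum_range_reflect]
  congr 1
  refine Finset.sum_congr rfl fun j hj => ?_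
  have hj := Finset.mem_range.1 hj
  obtain ⟨i, rfl⟩ := Nat.exists_eq_add_of_lt hj
  have h1 : 1 + (j + i + 1 - 1 - j) = i + 1 := by omega
  have h2 : j + i + 1 - j = i + 1 := by omega
  have h3 : (j + i + 1).succ - (i + 1) = j + 1 := by omega
  rw [h1, h2, h3, multisetCount, zeroCount]
  push_cast [Nat.add_sub_cancel]
  ring

theorem multisetCount_eq (k : ℕ) :
    multisetCount k = 1 + ∑ j ∈ Finset.range k,
      (((k : ℝ) - 1 - j) * multisetCount j + zeroCount j) := by
  have := sum_reversingFinset_succ k fun _ => 1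
  simpa [multisetCount] using this

theorem zeroCount_eq (k : ℕ) :
    zeroCount k = k + 1 + ∑ j ∈ Finset.range k,
      ((k : ℝ) - j) * (((k : ℝ) - 1 - j) * multisetCount j + zeroCount j) := by
  have := sum_reversingFinset_succ k fun n => n
  rw [zeroCount, this]
  push_cast
  congr 1
  refine Finset.sum_congr rfl fun j hj => ?_
  rw [Nat.cast_sub (Finset.mem_range.1 hj).le]

theorem multisetCount_succ (k : ℕ) :
    multisetCount (k + 1) =
      multisetCount k + zeroCount k + ∑ j ∈ Finset.range k, multisetCount j := by
  have h := multisetCount_eq (k + 1)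
  rw [Finset.sum_range_succ] at h
  have hk := multisetCount_eq k
  have : ∑ j ∈ Finset.range k, ((((k + 1 : ℕ) : ℝ) - 1 - j) * multisetCount j + zeroCount j) =
      ∑ j ∈ Finset.range k, (((k : ℝ) - 1 - j) * multisetCount j + zeroCount j) +
        ∑ j ∈ Finset.range k, multisetCount j := by
    rw [← Finset.sum_add_distrib]
    refine Finset.sum_congr rfl fun j _ => ?_
    push_cast
    ring
  rw [this] at h
  push_cast at h
  linarith

theorem zeroCount_succ (k : ℕ) :
    zeroCount (k + 1) = 2 * zeroCount k + multisetCount k +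
      ∑ j ∈ Finset.range k, ((k : ℝ) + 1 - j) * multisetCount j := by
  have h1 := zeroCount_eq (k + 1)
  rw [Finset.sum_range_succ] at h1
  have h2 : ∑ j ∈ Finset.range k, (((k + 1 : ℕ) : ℝ) - j) *
        ((((k + 1 : ℕ) : ℝ) - 1 - j) * multisetCount j + zeroCount j) =
      ∑ j ∈ Finset.range k, ((k : ℝ) - j) * (((k : ℝ) - 1 - j) * multisetCount j + zeroCount j) +
      ∑ j ∈ Finset.range k, (((k : ℝ) - 1 - j) * multisetCount j + zeroCount j) +
      ∑ j ∈ Finset.range k, ((k : ℝ) + 1 - j) * multisetCount j := by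
    rw [← Finset.sum_add_distrib, ← Finset.sum_add_distrib]
    refine Finset.sum_congr rfl fun j _ => ?_
    push_cast
    ring
  rw [h2] at h1
  push_cast at h1
  linarith [multisetCount_eq k, zeroCount_eq k]

theorem sum_weighted_succ (k : ℕ) :
    ∑ j ∈ Finset.range (k + 1), (((k + 1 : ℕ) : ℝ) + 1 - j) * multisetCount j =
      ∑ j ∈ Finset.range k, ((k : ℝ) + 1 - j) * multisetCount j +
        ∑ j ∈ Finset.range k, multisetCount j + 2 * multisetCount k := by
  rw [Finset.sum_range_succ, ← Finset.sum_add_distrib]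
  congr 1
  · refine Finset.sum_congr rfl fun j _ => ?_
    push_cast
    ring
  · push_cast
    ring

theorem multisetCount_recurrence (k : ℕ) :
    multisetCount (k + 4) =
      5 * multisetCount (k + 3) - 7 * multisetCount (k + 2) + 4 * multisetCount (k + 1) := by
  have p0 := multisetCount_succ k
  have p1 := multisetCount_succ (k + 1)
  have p2 := multisetCount_succ (k + 2)
  have p3 := multisetCount_succ (k + 3)
  have q0 := zeroCount_succ k
  have q1 := zeroCount_succ (k + 1)
  have q2 := zeroCount_succ (k + 2)
  have t0 := sum_weighted_succ k
  have t1 := sum_weighted_succ (k + 1)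
  rw [t0] at q1
  rw [t1, t0] at q2
  simp only [Finset.sum_range_succ] at p0 p1 p2 p3 q0 q1 q2
  linarith

theorem multisetCount_zero : multisetCount 0 = 1 := by
  rw [multisetCount_eq]; simp

theorem zeroCount_zero : zeroCount 0 = 1 := by
  rw [zeroCount_eq]; simp

theorem multisetCount_one : multisetCount 1 = 2 := by
  rw [multisetCount_succ, multisetCount_zero, zeroCount_zero]; norm_num

theorem zeroCount_one : zeroCount 1 = 3 := by
  rw [zeroCount_succ, multisetCount_zero, zeroCount_zero]; norm_num

theorem multisetCount_two : multisetCount 2 = 6 := by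
  rw [multisetCount_succ, multisetCount_one, zeroCount_one, Finset.sum_range_one,
    multisetCount_zero]
  norm_num

theorem zeroCount_two : zeroCount 2 = 10 := by
  rw [zeroCount_succ, multisetCount_one, zeroCount_one, Finset.sum_range_one, multisetCount_zero]
  norm_num

theorem multisetCount_three : multisetCount 3 = 19 := by
  rw [multisetCount_succ, multisetCount_two, zeroCount_two, Finset.sum_range_succ,
    Finset.sum_range_one, multisetCount_zero, multisetCount_one]
  norm_num

theorem periodCount_succ (k : ℕ) : (periodCount (k + 1) : ℝ) = multisetCount k := by
  rw [periodCount, Nat.card_congr unlabelledEquiv, Fintype.card_fin, multisetCount,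
    reversingFinset, ← Set.ncard_eq_toFinset_card _ (finite_reversingMultisets (k + 1)),
    Nat.card_coe_set_eq]

theorem finite_unlabelledPeriodConfiguration (k : ℕ) :
    Finite (UnlabelledPeriodConfiguration (⊤ : SimpleGraph (Fin k))) := by
  cases k with
  | zero => infer_instance
  | succ k =>
    have := (finite_reversingMultisets (Fintype.card (Fin (k + 1)))).to_subtype
    exact Finite.of_equiv _ unlabelledEquiv.symm

end Recurrence

section Asymptotics

theorem exists_cubic_root :
    ∃ α : ℝ, 3.2055694 < α ∧ α < 3.2055695 ∧ α ^ 3 - 5 * α ^ 2 + 7 * α - 4 = 0 := by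
  have hf : ContinuousOn (fun x : ℝ => x ^ 3 - 5 * x ^ 2 + 7 * x - 4)
      (Set.Icc 3.2055694 3.2055695) := by fun_prop
  obtain ⟨α, ⟨h1, h2⟩, h⟩ := intermediate_value_Ioo (by norm_num) hf
    (show (0 : ℝ) ∈ Set.Ioo _ _ by constructor <;> norm_num)
  exact ⟨α, h1, h2, h⟩

/-- A sequence satisfying a cubic recurrence with a real characteristic root `α` above `3`, the
quotient polynomial being small, is asymptotic to a multiple of `α ^ k`. -/
theorem tendsto_div_pow_of_recurrence {u : ℕ → ℝ} {α b d : ℝ} (hα : 3 < α)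
    (hb : |b| ≤ 2) (hd : |d| ≤ 2) (hne : α ^ 2 + b * α + d ≠ 0)
    (hu : ∀ k, u (k + 3) = (α - b) * u (k + 2) + (α * b - d) * u (k + 1) + α * d * u k) :
    Filter.Tendsto (fun k => u k / α ^ k) Filter.atTop
      (nhds ((u 2 + b * u 1 + d * u 0) / (α ^ 2 + b * α + d))) := by
  set c := (u 2 + b * u 1 + d * u 0) / (α ^ 2 + b * α + d) with hc
  have hw : ∀ k, u (k + 2) + b * u (k + 1) + d * u k =
      (u 2 + b * u 1 + d * u 0) * α ^ k := by
    intro k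
    induction k with
    | zero => simp
    | succ k ih =>
      rw [pow_succ, ← mul_assoc, ← ih, hu]
      ring
  have hr : ∀ k, u (k + 2) - c * α ^ (k + 2) =
      -b * (u (k + 1) - c * α ^ (k + 1)) - d * (u k - c * α ^ k) := by
    intro k
    have h1 : c * (α ^ 2 + b * α + d) = u 2 + b * u 1 + d * u 0 := div_mul_cancel₀ _ hne
    have h2 := hw k
    rw [← h1] at h2
    linear_combination h2
  obtain ⟨K, hK0, hK1⟩ : ∃ K, |u 0 - c * α ^ 0| ≤ K ∧ |u 1 - c * α ^ 1| ≤ K :=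
    ⟨_, le_max_left _ _, le_max_right _ _⟩
  have hKnn : 0 ≤ K := (abs_nonneg _).trans hK0
  have hbound : ∀ k, |u k - c * α ^ k| ≤ K * 3 ^ k ∧
      |u (k + 1) - c * α ^ (k + 1)| ≤ K * 3 ^ (k + 1) := by
    intro k
    induction k with
    | zero => exact ⟨by simpa using hK0, by simpa using hK1.trans (by linarith)⟩
    | succ k ih =>
      refine ⟨ih.2, ?_⟩
      rw [hr k]
      calc |-b * (u (k + 1) - c * α ^ (k + 1)) - d * (u k - c * α ^ k)|
          ≤ |-b * (u (k + 1) - c * α ^ (k + 1))| + |d * (u k - c * α ^ k)| := abs_sub _ _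
        _ = |b| * |u (k + 1) - c * α ^ (k + 1)| + |d| * |u k - c * α ^ k| := by
          rw [abs_mul, abs_mul, abs_neg]
        _ ≤ 2 * (K * 3 ^ (k + 1)) + 2 * (K * 3 ^ k) := by
          gcongr
          · exact ih.2
          · exact ih.1
        _ ≤ K * 3 ^ (k + 1 + 1) := by
          have : 0 ≤ K * 3 ^ k := by positivity
          rw [pow_succ 3 (k + 1), pow_succ 3 k]
          linarith
  have hα0 : 0 < α := by linarith
  have hgeom : Filter.Tendsto (fun k : ℕ => K * (3 / α) ^ k) Filter.atTop (nhds 0) := by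
    have := (tendsto_pow_atTop_nhds_zero_of_lt_one (r := 3 / α) (by positivity)
      ((div_lt_one hα0).2 hα)).const_mul K
    rwa [mul_zero] at this
  rw [tendsto_iff_norm_sub_tendsto_zero]
  refine squeeze_zero (fun _ => norm_nonneg _) (fun k => ?_) hgeom
  have hk : u k / α ^ k - c = (u k - c * α ^ k) / α ^ k := by
    field_simp
  rw [hk, Real.norm_eq_abs, abs_div, abs_of_pos (pow_pos hα0 k), div_pow, ← mul_div_assoc]
  gcongr
  exact (hbound k).1

theorem isEquivalent_of_tendsto_div_pow {a : ℕ → ℝ} {α c : ℝ} (hα : 0 < α) (hc : c ≠ 0)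
    (h : Filter.Tendsto (fun k => a k / α ^ k) Filter.atTop (nhds c)) :
    Asymptotics.IsEquivalent Filter.atTop a (fun k => c * α ^ k) := by
  rw [Asymptotics.isEquivalent_iff_tendsto_one
    (Filter.Eventually.of_forall fun k => mul_ne_zero hc (pow_pos hα k).ne')]
  have := h.div_const c
  rw [div_self hc] at this
  refine this.congr fun k => ?_
  rw [Pi.div_apply, div_div, mul_comm]

theorem roots_cubic {α : ℝ} {β : ℂ} (hsum : 2 * β.re = 5 - α) (hprod : ‖β‖ ^ 2 = 4 / α)
    (hα : α ≠ 0) (hroot : α ^ 3 - 5 * α ^ 2 + 7 * α - 4 = 0) :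
    (Polynomial.X ^ 3 - 5 * Polynomial.X ^ 2 + 7 * Polynomial.X - 4 : Polynomial ℂ).roots =
      {(α : ℂ), β, (starRingEnd ℂ) β} := by
  have h1 : β + (starRingEnd ℂ) β = 5 - α := by
    rw [Complex.add_conj, hsum]; push_cast; ring
  have h2 : α * (β * (starRingEnd ℂ) β) = 4 := by
    rw [Complex.mul_conj, Complex.normSq_eq_norm_sq, hprod, ← Complex.ofReal_mul,
      mul_div_cancel₀ _ hα]
    norm_num
  have h3 : (α : ℂ) * (β + (starRingEnd ℂ) β) + β * (starRingEnd ℂ) β = 7 := by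
    have hα' : (α : ℂ) ≠ 0 := Complex.ofReal_ne_zero.2 hα
    have hr : (α : ℂ) ^ 3 - 5 * α ^ 2 + 7 * α - 4 = 0 := by exact_mod_cast hroot
    apply mul_left_cancel₀ hα'
    rw [mul_add, h2, h1]
    linear_combination -hr
  have h : (Polynomial.X ^ 3 - 5 * Polynomial.X ^ 2 + 7 * Polynomial.X - 4 : Polynomial ℂ) =
      (({(α : ℂ), β, (starRingEnd ℂ) β} : Multiset ℂ).map
        fun a => Polynomial.X - Polynomial.C a).prod := by
    have e1 : (5 : Polynomial ℂ) = Polynomial.C ((α : ℂ) + (β + (starRingEnd ℂ) β)) := by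
      rw [h1, add_sub_cancel]; rfl
    have e2 : (7 : Polynomial ℂ) =
        Polynomial.C ((α : ℂ) * (β + (starRingEnd ℂ) β) + β * (starRingEnd ℂ) β) := by
      rw [h3]; rfl
    have e3 : (4 : Polynomial ℂ) = Polynomial.C ((α : ℂ) * (β * (starRingEnd ℂ) β)) := by
      rw [h2]; rfl
    rw [e1, e2, e3]
    simp only [Multiset.insert_eq_cons, Multiset.map_cons, Multiset.map_singleton,
      Multiset.prod_cons, Multiset.prod_singleton, map_add, map_mul]
    ring
  rw [h, Polynomial.roots_multiset_prod_X_sub_C]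

theorem exists_conjugate_root {b d : ℝ} (h : b ^ 2 < 4 * d) :
    ∃ β : ℂ, 2 * β.re = -b ∧ ‖β‖ ^ 2 = d ∧ β.im ≠ 0 := by
  have hpos : 0 < d - (b / 2) ^ 2 := by linarith [div_pow b 2 2]
  refine ⟨⟨-b / 2, √(d - (b / 2) ^ 2)⟩, by ring, ?_, (Real.sqrt_pos.2 hpos).ne'⟩
  rw [← Complex.normSq_eq_norm_sq, Complex.normSq_mk, Real.mul_self_sqrt hpos.le]
  ring

end Asymptotics

end Diffusion

theorem mainTheorem3 :
    (∀ k : ℕ, Finite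
      (Diffusion.UnlabelledPeriodConfiguration (⊤ : SimpleGraph (Fin k)))) ∧
    ∃ (c α : ℝ) (β : ℂ),
      (Polynomial.X ^ 3 - 5 * Polynomial.X ^ 2 + 7 * Polynomial.X - 4 :
          Polynomial ℂ).roots = {(α : ℂ), β, (starRingEnd ℂ) β} ∧
      β.im ≠ 0 ∧
      ‖β‖ < α ∧
      |α - 3.2056| < 0.00005 ∧
      |‖β‖ - 1.1171| < 0.00005 ∧
      |c - 0.1809| < 0.00005 ∧
      Asymptotics.IsEquivalent Filter.atTop
        (fun k : ℕ => (Diffusion.periodCount k : ℝ)) (fun k : ℕ => c * α ^ k) := by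
  refine ⟨Diffusion.finite_unlabelledPeriodConfiguration, ?_⟩
  obtain ⟨α, hl, hu, hroot⟩ := Diffusion.exists_cubic_root
  have hα : 0 < α := by linarith
  have hd : 1.247828 < 4 / α ∧ 4 / α < 1.2478283 := by
    rw [lt_div_iff₀ hα, div_lt_iff₀ hα]
    constructor <;> linarith
  obtain ⟨β, hre, hnorm, him⟩ := Diffusion.exists_conjugate_root (b := α - 5) (d := 4 / α)
    (by nlinarith)
  have hβl : 1.11706 < ‖β‖ := lt_of_pow_lt_pow_left₀ 2 (norm_nonneg β) (by linarith)
  have hβu : ‖β‖ < 1.11707 := lt_of_pow_lt_pow_left₀ 2 (by norm_num) (by linarith)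
  have hsq : 10.27567 < α ^ 2 ∧ α ^ 2 < 10.275676 := by constructor <;> nlinarith
  have hden : 5.77 < α ^ 2 + (α - 5) * α + 4 / α := by nlinarith
  have hden0 : α ^ 2 + (α - 5) * α + 4 / α ≠ 0 := by linarith
  have hαd : α * (4 / α) = 4 := mul_div_cancel₀ _ hα.ne'
  have hlim := Diffusion.tendsto_div_pow_of_recurrence
    (u := fun k => Diffusion.multisetCount (k + 1)) (α := α) (b := α - 5) (d := 4 / α)
    (by linarith) (abs_le.2 ⟨by linarith, by linarith⟩) (abs_le.2 ⟨by linarith, by linarith⟩)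
    hden0 (by
      intro k
      have h7 : α * (α - 5) - 4 / α = -7 := by
        apply mul_left_cancel₀ hα.ne'
        rw [mul_sub, hαd]
        linear_combination hroot
      rw [h7, hαd, Diffusion.multisetCount_recurrence k]
      ring)
  simp only [zero_add, Nat.reduceAdd, Diffusion.multisetCount_one, Diffusion.multisetCount_two,
    Diffusion.multisetCount_three] at hlim
  set c := (19 + (α - 5) * 6 + 4 / α * 2) / (α ^ 2 + (α - 5) * α + 4 / α) with hc
  have hcl : 0.18086 < c / α ^ 2 ∧ c / α ^ 2 < 0.18094 := by
    have h1 : 1.8590 < c ∧ c < 1.8591 := by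
      rw [hc, lt_div_iff₀ (by linarith), div_lt_iff₀ (by linarith)]
      constructor <;> nlinarith
    rw [lt_div_iff₀ (by positivity), div_lt_iff₀ (by positivity)]
    constructor <;> linarith
  refine ⟨c / α ^ 2, α, β, Diffusion.roots_cubic (by linarith) hnorm hα.ne' hroot, him,
    by linarith, abs_lt.2 ⟨by linarith, by linarith⟩, abs_lt.2 ⟨by linarith, by linarith⟩,
    abs_lt.2 ⟨by linarith, by linarith⟩, ?_⟩
  refine Diffusion.isEquivalent_of_tendsto_div_pow hα (by linarith) ?_
  rw [← Filter.tendsto_add_atTop_iff_nat 2]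
  refine (hlim.div_const (α ^ 2)).congr fun k => ?_
  rw [Diffusion.periodCount_succ, div_div, ← pow_add]
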